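/- Let $V$ be a finite set. A DAG on $V$ is a directed graph $\mathcal G=(V,E)$ that contains every self-loop $i\to i$ and has no directed cycle of length greater than one. Let $C$ be a diagonal positive definite real $V\times V$ matrix. The graphical continuous Lyapunov model (GCLM) of $\mathcal G$ is given by the set of covariance matrices $$\mathcal M_{\mathcal G,C}=\{\Sigma \text{ positive definite} : M\Sigma+\Sigma M^T+C=0 \text{ for a stable real matrix } M \text{ with } m_{ji}=0 \text{ whenever } i\to j\notin E\},$$ where a matrix is stable if all its complex eigenvalues have negative real part. Two DAGs on $V$ are Lyapunov model equivalent if $\mathcal M_{\mathcal G_1,C}=\mathcal M_{\mathcal G_2,C}$. They are Markov equivalent (as Bayesian networks) if they have the same d-separations: for all pairwise disjoint $A,B,Z\subseteq V$, the set $Z$ d-separates $A$ and $B$ in $\mathcal G_1$ if and only if it does so in $\mathcal G_2$ (where $Z$ d-separates $A$ and $B$ if every path without repeated vertices in the skeleton between a vertex of $A$ and a vertex of $B$ has an inner vertex that either is a non-collider on the path and lies in $Z$, or is a collider on the path and neither it nor any of its descendants lies in $Z$). Then the partition of the set of DAGs on $V$ into Lyapunov model equivalence classes refines the partition into Markov equivalence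 classes. In other words, if two DAGs on $V$ are not Markov equivalent, then they are not Lyapunov model equivalent. In particular this holds for $C=2I$. -/

import Mathlib

/-- A directed acyclic graph on `V`. All self-loops belong to the edge set, and acyclicity is
understood after ignoring them: there is no directed cycle of length greater than one. -/
structure DAG (V : Type*) extends Digraph V where
  loop : ∀ i, Adj i i
  acyclic : ∀ i, ¬ Relation.TransGen (fun a b => a ≠ b ∧ Adj a b) i i

namespace DAG

variable {V : Type*}

/-- The edges `i → j` other than the self-loops. -/
def Arrow (G : DAG V) (i j : V) : Prop := i ≠ j ∧ G.Adj i j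

/-! ### Lyapunov models -/

/-- A real matrix is stable if all its complex eigenvalues have negative real part. -/
def IsStable [Fintype V] [DecidableEq V] (M : Matrix V V ℝ) : Prop :=
  ∀ z ∈ spectrum ℂ (M.map (algebraMap ℝ ℂ)), z.re < 0

/-- The space `ℝ^E` of the matrices `M` with `M j i = 0` whenever `i → j` is not an edge. -/
def sparse (G : DAG V) : Set (Matrix V V ℝ) :=
  {M | ∀ i j, ¬ G.Adj i j → M j i = 0}

/-- The graphical continuous Lyapunov model of `G` with volatility matrix `C`, as the set of
covariance matrices of its centred normal distributions. -/
def lyapunovModel [Fintype V] [DecidableEq V] (C : Matrix V V ℝ) (G : DAG V) :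
    Set (Matrix V V ℝ) :=
  {S | S.PosDef ∧ ∃ M ∈ G.sparse, IsStable M ∧ M * S + S * M.transpose + C = 0}

/-- Model equivalence in the Lyapunov sense. -/
def ModelEquivalent [Fintype V] [DecidableEq V] (C : Matrix V V ℝ) (G₁ G₂ : DAG V) : Prop :=
  lyapunovModel C G₁ = lyapunovModel C G₂

/-- Model equivalence as an equivalence relation on the DAGs on `V`. -/
def modelSetoid [Fintype V] [DecidableEq V] (C : Matrix V V ℝ) : Setoid (DAG V) where
  r := ModelEquivalent C
  iseqv := ⟨fun _ => rfl, fun h => Eq.symm h, fun h h' => Eq.trans h h'⟩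

/-! ### Markov equivalence -/

/-- The skeleton: the undirected simple graph obtained by dropping loops and orientations. -/
def skeleton (G : DAG V) : SimpleGraph V := G.toDigraph.toSimpleGraphInclusive

/-- `Z` does not block the walk `p`: every inner vertex of `p` at which two arrows meet head to
head is in `Z` or has a descendant in `Z`, and no other inner vertex of `p` is in `Z`. -/
def IsActive (G : DAG V) (Z : Set V) {a b : V} (p : G.skeleton.Walk a b) : Prop :=
  ∀ k, k + 2 ≤ p.length →
    ((G.Arrow (p.getVert k) (p.getVert (k + 1)) ∧
        G.Arrow (p.getVert (k + 2)) (p.getVert (k + 1))) →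
      ∃ d ∈ Z, Relation.ReflTransGen G.Arrow (p.getVert (k + 1)) d) ∧
    (¬ (G.Arrow (p.getVert k) (p.getVert (k + 1)) ∧
        G.Arrow (p.getVert (k + 2)) (p.getVert (k + 1))) →
      p.getVert (k + 1) ∉ Z)

/-- `A` and `B` are d-separated by `Z`: every path (with arbitrary edge directions and without
repeated vertices) between a vertex of `A` and a vertex of `B` is blocked by `Z`. -/
def DSeparated (G : DAG V) (A B Z : Set V) : Prop :=
  ∀ a ∈ A, ∀ b ∈ B, ∀ p : G.skeleton.Walk a b, p.IsPath → ¬ G.IsActive Z p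

/-- Markov equivalence: the same d-separations between pairwise disjoint vertex sets. -/
def MarkovEquivalent (G₁ G₂ : DAG V) : Prop :=
  ∀ A B Z : Set V, Disjoint A B → Disjoint A Z → Disjoint B Z →
    (G₁.DSeparated A B Z ↔ G₂.DSeparated A B Z)

/-- Markov equivalence as an equivalence relation on the DAGs on `V`. -/
def markovSetoid (V : Type*) : Setoid (DAG V) where
  r := MarkovEquivalent
  iseqv :=
    ⟨fun _ _ _ _ _ _ _ => Iff.rfl,
     fun h A B Z h₁ h₂ h₃ => (h A B Z h₁ h₂ h₃).symm,
     fun h h' A B Z h₁ h₂ h₃ => (h A B Z h₁ h₂ h₃).trans (h' A B Z h₁ h₂ h₃)⟩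

end DAG

namespace DAG

/-! ### Blocked and unblocked triples. -/

section Markov

variable {V : Type*} {G H : DAG V} {Z : Set V}

/-! The bridge between the two equivalences is the pattern of a DAG: its skeleton together with its
unshielded colliders (`SamePattern`).

The Lyapunov model determines the pattern (`samePattern_of_modelEquivalent`). Explicit covariances
`starCov`, correlating a vertex only with chosen parents, lie in the model of `G`. If `H` lacked the
corresponding adjacency or unshielded collider, the forced zeros of `M` would make a few entries of
the Lyapunov equation inconsistent with the positive diagonal of `C`.

The pattern determines d-separation (`SamePattern.markovEquivalent`, the easier half of the
Verma–Pearl criterion). Among active sequences of minimal length between two vertices, take one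
whose vertices have least total distance to `Z`. Minimal length makes it a path whose colliders
agree in both graphs (`IsShortest.collider_iff`). Minimal distance makes the directed paths that
open its colliders survive in `H` (`IsShortest.activeSeq_of_samePattern`). -/

theorem arrow_asymm {a b : V} (h : G.Arrow a b) (h' : G.Arrow b a) : False :=
  G.acyclic a (.tail (.single h) h')

theorem arrow_no_triangle {a b c : V} (h : G.Arrow a b) (h' : G.Arrow b c)
    (h'' : G.Arrow c a) : False :=
  G.acyclic a (.tail (.tail (.single h) h') h'')

theorem skeleton_adj {a b : V} : G.skeleton.Adj a b ↔ G.Arrow a b ∨ G.Arrow b a := by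
  simp only [skeleton, Digraph.toSimpleGraphInclusive, SimpleGraph.fromRel_adj, Arrow]
  constructor
  · rintro ⟨h, h' | h'⟩
    exacts [.inl ⟨h, h'⟩, .inr ⟨h.symm, h'⟩]
  · rintro (⟨h, h'⟩ | ⟨h, h'⟩)
    exacts [⟨h, .inl h'⟩, ⟨h.symm, .inr h'⟩]

/-- Two arrows meet head to head at the middle vertex `y`. -/
def Collider (G : DAG V) (x y z : V) : Prop := G.Arrow x y ∧ G.Arrow z y

/-- The vertex `y` has a descendant in `Z`. -/
def Reaches (G : DAG V) (Z : Set V) (y : V) : Prop :=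
  ∃ d ∈ Z, Relation.ReflTransGen G.Arrow y d

/-- The middle vertex of the triple `x, y, z` does not block it given `Z`. -/
def Unblocked (G : DAG V) (Z : Set V) (x y z : V) : Prop :=
  (G.Collider x y z → G.Reaches Z y) ∧ (¬ G.Collider x y z → y ∉ Z)

theorem Reaches.head {y d : V} (h : G.Arrow y d) (hd : G.Reaches Z d) : G.Reaches Z y :=
  let ⟨e, he, hde⟩ := hd
  ⟨e, he, .head h hde⟩

theorem reaches_of_mem {y : V} (h : y ∈ Z) : G.Reaches Z y := ⟨y, h, .refl⟩

theorem Collider.symm {x y z : V} (h : G.Collider x y z) : G.Collider z y x := ⟨h.2, h.1⟩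

theorem Unblocked.symm {x y z : V} (h : G.Unblocked Z x y z) : G.Unblocked Z z y x :=
  ⟨fun hc => h.1 hc.symm, fun hc => h.2 fun hc' => hc hc'.symm⟩

/-- An arrow leaves `x` in both triples, so `x` is a non-collider before and after the change. -/
theorem Unblocked.of_arrow_left {w x y z : V} (h : G.Unblocked Z w x y) (hxy : G.Arrow x y)
    (hxz : G.Arrow x z) : G.Unblocked Z w x z :=
  ⟨fun hc => (arrow_asymm hxz hc.2).elim, fun _ => h.2 fun hc => arrow_asymm hxy hc.2⟩

theorem Unblocked.of_arrow_right {x y z v : V} (h : G.Unblocked Z y z v) (hyz : G.Arrow y z)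
    (hxz : G.Arrow x z) : G.Unblocked Z x z v :=
  ⟨fun hc => h.1 ⟨hyz, hc.2⟩, fun hc => h.2 fun hc' => hc ⟨hxz, hc'.2⟩⟩

/-- The middle vertex was a non-collider, hence outside `Z`; should it become a collider, `hz` opens
it. -/
theorem Unblocked.of_arrow_out {x y z v : V} (h : G.Unblocked Z y z v) (hzy : G.Arrow z y)
    (hz : G.Reaches Z z) : G.Unblocked Z x z v :=
  ⟨fun _ => hz, fun _ => h.2 fun hc => arrow_asymm hzy hc.1⟩

/-! ### Active sequences and shortcuts. -/

/-- A sequence `f 0, …, f n` of consecutively adjacent vertices that is not blocked by `Z`. -/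
structure ActiveSeq (G : DAG V) (Z : Set V) (n : ℕ) (f : ℕ → V) : Prop where
  adj : ∀ k < n, G.skeleton.Adj (f k) (f (k + 1))
  unblocked : ∀ k, k + 2 ≤ n → G.Unblocked Z (f k) (f (k + 1)) (f (k + 2))

theorem ActiveSeq.reverse {n : ℕ} {f : ℕ → V} (h : G.ActiveSeq Z n f) :
    G.ActiveSeq Z n (fun k => f (n - k)) where
  adj k hk := by
    have := (h.adj (n - (k + 1)) (by omega)).symm
    rwa [show n - (k + 1) + 1 = n - k by omega] at this
  unblocked k hk := by
    have := (h.unblocked (n - (k + 2)) (by omega)).symm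
    rwa [show n - (k + 2) + 1 = n - (k + 1) by omega,
      show n - (k + 2) + 2 = n - k by omega] at this

theorem ActiveSeq.take {n m : ℕ} {f : ℕ → V} (h : G.ActiveSeq Z n f) (hm : m ≤ n) :
    G.ActiveSeq Z m f :=
  ⟨fun k hk => h.adj k (by omega), fun k hk => h.unblocked k (by omega)⟩

/-- Dropping `d` consecutive vertices alters only the triples centred at the two ends of the new
edge. Both conditions are vacuous when that end is an end of the sequence. -/
theorem ActiveSeq.shortcut {n i d : ℕ} {f : ℕ → V} (h : G.ActiveSeq Z n f) (hid : i + 1 + d ≤ n)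
    (hadj : G.skeleton.Adj (f i) (f (i + 1 + d)))
    (hL : ∀ k, k + 1 = i → G.Unblocked Z (f k) (f (k + 1)) (f (i + 1 + d)))
    (hR : i + 1 + d + 1 ≤ n → G.Unblocked Z (f i) (f (i + 1 + d)) (f (i + 1 + d + 1))) :
    G.ActiveSeq Z (n - d) (fun k => if k ≤ i then f k else f (k + d)) where
  adj k hk := by
    rcases lt_trichotomy k i with hki | rfl | hki
    · simpa [show k ≤ i by omega, show k + 1 ≤ i by omega] using h.adj k (by omega)
    · simpa using hadj
    · simpa [show ¬ k ≤ i by omega, show ¬ k + 1 ≤ i by omega,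
        show k + 1 + d = k + d + 1 by omega] using h.adj (k + d) (by omega)
  unblocked k hk := by
    rcases lt_trichotomy k i with hki | rfl | hki
    · rcases Nat.lt_or_ge (k + 1) i with hki' | hki'
      · simpa [show k ≤ i by omega, show k + 1 ≤ i by omega, show k + 2 ≤ i by omega]
          using h.unblocked k (by omega)
      · obtain rfl : k + 1 = i := by omega
        simpa [show k ≤ k + 1 by omega] using hL k rfl
    · simpa [show k + 2 + d = k + 1 + d + 1 by omega] using hR (by omega)
    · simpa [show ¬ k ≤ i by omega, show ¬ k + 1 ≤ i by omega, show ¬ k + 2 ≤ i by omega,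
        show k + 1 + d = k + d + 1 by omega, show k + 2 + d = k + d + 2 by omega]
        using h.unblocked (k + d) (by omega)

/-- Following a sequence out of `f i` along an arrow leads to a collider or to the end. -/
theorem ActiveSeq.reaches_or_transGen {n i j : ℕ} {f : ℕ → V} (h : G.ActiveSeq Z n f)
    (hij : i < j) (hj : j ≤ n) (ha : G.Arrow (f i) (f (i + 1))) :
    G.Reaches Z (f i) ∨
      (Relation.TransGen G.Arrow (f i) (f j) ∧ G.Arrow (f (j - 1)) (f j)) := by
  induction j, hij using Nat.le_induction with
  | base => exact .inr ⟨.single ha, by simpa using ha⟩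
  | succ j hij ih =>
    rcases ih (by omega) with hr | ⟨ht, hl⟩
    · exact .inl hr
    obtain ⟨j, rfl⟩ : ∃ k, j = k + 1 := ⟨j - 1, by omega⟩
    simp only [Nat.add_sub_cancel] at hl ⊢
    rcases skeleton_adj.1 (h.adj (j + 1) (by omega)) with hr | hr
    · exact .inr ⟨ht.tail hr, hr⟩
    · obtain ⟨e, he, hje⟩ := (h.unblocked j (by omega)).1 ⟨hl, hr⟩
      exact .inl ⟨e, he, ht.to_reflTransGen.trans hje⟩

/-! ### Geometry of shortest active sequences. -/

/-- An active sequence of minimal length between its ends. -/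
def IsShortest (G : DAG V) (Z : Set V) (n : ℕ) (f : ℕ → V) : Prop :=
  G.ActiveSeq Z n f ∧
    ∀ m g, G.ActiveSeq Z m g → g 0 = f 0 → g m = f n → n ≤ m

theorem IsShortest.reverse {n : ℕ} {f : ℕ → V} (h : G.IsShortest Z n f) :
    G.IsShortest Z n (fun k => f (n - k)) :=
  ⟨h.1.reverse, fun m g hg h0 hm => h.2 m _ hg.reverse (by simpa using hm) (by simpa using h0)⟩

theorem IsShortest.no_shortcut {n i d : ℕ} {f : ℕ → V} (h : G.IsShortest Z n f) (hd : 0 < d)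
    (hid : i + 1 + d ≤ n) (hadj : G.skeleton.Adj (f i) (f (i + 1 + d)))
    (hL : ∀ k, k + 1 = i → G.Unblocked Z (f k) (f (k + 1)) (f (i + 1 + d)))
    (hR : i + 1 + d + 1 ≤ n → G.Unblocked Z (f i) (f (i + 1 + d)) (f (i + 1 + d + 1))) :
    False := by
  have := h.2 _ _ (h.1.shortcut hid hadj hL hR) (by simp)
    (by simp [show ¬ n - d ≤ i by omega, show n - d + d = n by omega])
  omega

/-- The loop between two visits of a vertex could be cut out. -/
theorem IsShortest.ne {n i j : ℕ} {f : ℕ → V} (h : G.IsShortest Z n f) (hij : i < j)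
    (hj : j ≤ n) : f i ≠ f j := by
  intro he
  rcases Nat.lt_or_ge j n with hjn | hjn
  · obtain ⟨d, rfl⟩ : ∃ d, j = i + d := ⟨j - i, by omega⟩
    refine h.no_shortcut (i := i) (d := d) (by omega) (by omega) ?_ ?_ ?_
    · rw [he, show i + 1 + d = i + d + 1 by omega]
      exact h.1.adj _ hjn
    · rintro k rfl
      obtain ⟨m, hm⟩ : ∃ m, k + 1 + d = m + 1 := ⟨k + d, by omega⟩
      have hu := h.1.unblocked k (by omega)
      have hu' := h.1.unblocked m (by omega)
      rw [show k + 1 + 1 + d = m + 2 by omega]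
      rw [hm] at he
      rw [← he] at hu'
      -- If cutting creates a collider, either it already was one, or the loop leaves it along an
      -- arrow and, by acyclicity, meets a collider that reaches `Z`. If the vertex lies in `Z`,
      -- both visits were colliders, and so is the spliced triple.
      refine ⟨fun hc => ?_, fun hc hz => ?_⟩
      · rcases skeleton_adj.1 (h.1.adj (k + 1) (by omega)) with ha | ha
        · rcases h.1.reaches_or_transGen (j := m + 1) (by omega) (by omega) ha with hr | hr
          · exact hr
          · rw [← he] at hr
            exact (G.acyclic _ hr.1).elim
        · exact hu.1 ⟨hc.1, ha⟩
      · by_cases h1 : G.Collider (f k) (f (k + 1)) (f (k + 2))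
        · by_cases h2 : G.Collider (f m) (f (k + 1)) (f (m + 2))
          · exact hc ⟨h1.1, h2.2⟩
          · exact hu'.2 h2 hz
        · exact hu.2 h1 hz
    · intro hn
      have := h.1.unblocked (i + d) (by omega)
      rwa [← he, show i + d + 1 = i + 1 + d by omega,
        show i + d + 2 = i + 1 + d + 1 by omega] at this
  -- No edge follows the second visit, so truncating at the first one suffices.
  · obtain rfl : j = n := by omega
    have := h.2 i f (h.1.take (by omega)) rfl he
    omega

theorem IsShortest.collider_not_arrow {n k : ℕ} {f : ℕ → V} (h : G.IsShortest Z n f)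
    (hk : k + 2 ≤ n) (hxy : G.Arrow (f k) (f (k + 1))) : ¬ G.Arrow (f k) (f (k + 2)) := by
  intro hxz
  refine h.no_shortcut (i := k) (d := 1) one_pos (by omega) (skeleton_adj.2 (.inl hxz)) ?_ ?_
  · rintro m rfl
    exact (h.1.unblocked m (by omega)).of_arrow_left hxy hxz
  · intro hn
    have hu := h.1.unblocked (k + 1) (by omega)
    rcases skeleton_adj.1 (h.1.adj (k + 1) (by omega)) with ha | ha
    · exact hu.of_arrow_right ha hxz
    · exact hu.of_arrow_out ha (((h.1.unblocked k hk).1 ⟨hxy, ha⟩).head ha)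

theorem IsShortest.collider_not_adj {n k : ℕ} {f : ℕ → V} (h : G.IsShortest Z n f)
    (hk : k + 2 ≤ n) (hc : G.Collider (f k) (f (k + 1)) (f (k + 2))) :
    ¬ G.skeleton.Adj (f k) (f (k + 2)) := by
  intro ha
  rcases skeleton_adj.1 ha with ha | ha
  · exact h.collider_not_arrow hk hc.1 ha
  · have := h.reverse.collider_not_arrow (k := n - (k + 2)) (by omega)
    simp only [show n - (n - (k + 2)) = k + 2 by omega,
      show n - (n - (k + 2) + 1) = k + 1 by omega,
      show n - (n - (k + 2) + 2) = k by omega] at this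
    exact this hc.2 ha

/-! ### Patterns and shielded triples. -/

/-- The two graphs have the same skeleton and the same unshielded colliders. -/
structure SamePattern (G H : DAG V) : Prop where
  adj : ∀ a b, G.skeleton.Adj a b ↔ H.skeleton.Adj a b
  collider : ∀ a b c, a ≠ c → ¬ G.skeleton.Adj a c → (G.Collider a b c ↔ H.Collider a b c)

theorem SamePattern.symm (h : SamePattern G H) : SamePattern H G :=
  ⟨fun a b => (h.adj a b).symm,
    fun a b c hac hn => (h.collider a b c hac (by rwa [h.adj])).symm⟩

/-- Orientation propagates along an unshielded chain. -/
theorem SamePattern.arrow_of_chain (h : SamePattern G H) {x y z : V} (hxz : x ≠ z)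
    (hn : ¬ G.skeleton.Adj x z) (hyz : G.Arrow y z) (hxy : H.Arrow x y) : H.Arrow y z := by
  rcases skeleton_adj.1 ((h.adj y z).1 (skeleton_adj.2 (.inl hyz))) with h' | h'
  · exact h'
  · exact (arrow_asymm hyz ((h.collider x y z hxz hn).2 ⟨hxy, h'⟩).2).elim

theorem SamePattern.arrow_of_collider (h : SamePattern G H) {a b c : V} (hc : G.Collider a b c)
    (hac : a ≠ c) (hn : ¬ G.skeleton.Adj a c) : H.Arrow a b ∧ H.Arrow c b :=
  (h.collider a b c hac hn).1 hc

/-- Write `x, y, z` for the triple. The shortcut past `y` can fail only at `x`, which forces a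
preceding collider `w → x ← y`. By minimality `w` is adjacent to neither `y` nor `z`, so `H`
inherits `y → x` and `x → z`, and acyclicity gives `y → z`. -/
theorem IsShortest.shielded {n k : ℕ} {f : ℕ → V} (h : G.IsShortest Z n f)
    (hGH : SamePattern G H) (hk : k + 2 ≤ n) (hxz : G.Arrow (f k) (f (k + 2))) :
    H.Arrow (f (k + 1)) (f (k + 2)) ∧ G.Arrow (f (k + 1)) (f (k + 2)) := by
  have hyx : G.Arrow (f (k + 1)) (f k) :=
    (skeleton_adj.1 (h.1.adj k (by omega))).resolve_left
      fun h' => h.collider_not_arrow hk h' hxz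
  have hyz : G.Arrow (f (k + 1)) (f (k + 2)) :=
    (skeleton_adj.1 (h.1.adj (k + 1) (by omega))).resolve_right
      fun h' => arrow_no_triangle h' hyx hxz
  refine ⟨?_, hyz⟩
  have hex : ¬ ∀ m, m + 1 = k → G.Unblocked Z (f m) (f (m + 1)) (f (k + 2)) := fun hL =>
    h.no_shortcut (i := k) (d := 1) one_pos (by omega) (skeleton_adj.2 (.inl hxz)) hL
      fun hn => (h.1.unblocked (k + 1) (by omega)).of_arrow_right hyz hxz
  push Not at hex
  obtain ⟨m, rfl, hm⟩ := hex
  have hu := h.1.unblocked m (by omega)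
  have hc : G.Collider (f m) (f (m + 1)) (f (m + 2)) := by
    by_contra hc
    exact hm ⟨fun hc' => (arrow_asymm hxz hc'.2).elim, fun _ => hu.2 hc⟩
  have hwy := h.collider_not_adj (by omega) hc
  have hwz : ¬ G.skeleton.Adj (f m) (f (m + 3)) := by
    intro hadj
    rcases skeleton_adj.1 hadj with ha | ha
    · refine h.no_shortcut (i := m) (d := 2) two_pos (by omega) hadj ?_ fun hn =>
        (h.1.unblocked (m + 2) (by omega)).of_arrow_right hyz ha
      rintro l rfl
      exact (h.1.unblocked l (by omega)).of_arrow_left hc.1 ha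
    · exact arrow_no_triangle ha hc.1 hxz
  have hH := hGH.arrow_of_collider hc (h.ne (by omega) (by omega)) hwy
  have hxz' : H.Arrow (f (m + 1)) (f (m + 3)) :=
    hGH.arrow_of_chain (h.ne (by omega) (by omega)) hwz hxz hH.1
  exact (skeleton_adj.1 ((hGH.adj _ _).1 (skeleton_adj.2 (.inl hyz)))).resolve_right
    fun h' => arrow_no_triangle h' hH.2 hxz'

theorem IsShortest.collider_iff {n k : ℕ} {f : ℕ → V} (h : G.IsShortest Z n f)
    (hGH : SamePattern G H) (hk : k + 2 ≤ n) :
    G.Collider (f k) (f (k + 1)) (f (k + 2)) ↔ H.Collider (f k) (f (k + 1)) (f (k + 2)) := by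
  by_cases hadj : G.skeleton.Adj (f k) (f (k + 2))
  · rcases skeleton_adj.1 hadj with ha | ha
    · obtain ⟨h1, h2⟩ := h.shielded hGH hk ha
      exact ⟨fun hc => (arrow_asymm h2 hc.2).elim, fun hc => (arrow_asymm h1 hc.2).elim⟩
    · have := h.reverse.shielded (k := n - (k + 2)) hGH (by omega)
      simp only [show n - (n - (k + 2)) = k + 2 by omega,
        show n - (n - (k + 2) + 1) = k + 1 by omega,
        show n - (n - (k + 2) + 2) = k by omega] at this
      obtain ⟨h1, h2⟩ := this ha
      exact ⟨fun hc => (arrow_asymm h2 hc.1).elim, fun hc => (arrow_asymm h1 hc.1).elim⟩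
  · exact hGH.collider _ _ _ (h.ne (by omega) (by omega)) hadj

/-! ### Distance to the conditioning set and transfer of activity. -/

/-- A directed path with `m` arrows leads from `y` into `Z`. -/
def ReachesIn (G : DAG V) (Z : Set V) : ℕ → V → Prop
  | 0, y => y ∈ Z
  | m + 1, y => ∃ d, G.Arrow y d ∧ G.ReachesIn Z m d

theorem ReachesIn.reaches : ∀ {m : ℕ} {y : V}, G.ReachesIn Z m y → G.Reaches Z y
  | 0, _, h => reaches_of_mem h
  | _ + 1, _, ⟨_, hd, h⟩ => h.reaches.head hd

theorem Reaches.reachesIn {y : V} (h : G.Reaches Z y) : ∃ m, G.ReachesIn Z m y := by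
  obtain ⟨d, hd, hyd⟩ := h
  induction hyd using Relation.ReflTransGen.head_induction_on with
  | refl => exact ⟨0, hd⟩
  | head hab _ ih =>
    obtain ⟨m, hm⟩ := ih
    exact ⟨m + 1, _, hab, hm⟩

/-- The length of a shortest directed path from `y` into `Z`. -/
noncomputable def height (G : DAG V) (Z : Set V) (y : V) : ℕ := sInf {m | G.ReachesIn Z m y}

theorem Reaches.reachesIn_height {y : V} (h : G.Reaches Z y) :
    G.ReachesIn Z (G.height Z y) y :=
  Nat.sInf_mem (s := {m | G.ReachesIn Z m y}) h.reachesIn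

theorem ReachesIn.height_le {m : ℕ} {y : V} (h : G.ReachesIn Z m y) : G.height Z y ≤ m :=
  Nat.sInf_le h

theorem Reaches.exists_next {y : V} (h : G.Reaches Z y) (hy : y ∉ Z) :
    ∃ d, G.Arrow y d ∧ G.Reaches Z d ∧ G.height Z y = G.height Z d + 1 := by
  have hm := h.reachesIn_height
  rcases hh : G.height Z y with _ | m
  · rw [hh] at hm
    exact (hy hm).elim
  · rw [hh] at hm
    obtain ⟨d, hyd, hd⟩ := hm
    refine ⟨d, hyd, hd.reaches, ?_⟩
    have h1 := hd.height_le
    have h2 : G.height Z y ≤ G.height Z d + 1 :=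
      ReachesIn.height_le ⟨d, hyd, hd.reaches.reachesIn_height⟩
    omega

/-- A shortest directed path into `Z` is an unshielded chain at each step: a chord would shorten it
or close a cycle. Hence its first arrow orients all the others in `H`. -/
theorem SamePattern.reaches_of_height (hGH : SamePattern G H) (m : ℕ) :
    ∀ y d, G.Reaches Z d → G.height Z d = m → G.height Z y = m + 1 → G.Arrow y d →
      H.Arrow y d → H.Reaches Z d := by
  induction m with
  | zero =>
    intro y d hd hm _ _ _
    have := hd.reachesIn_height
    rw [hm] at this
    exact reaches_of_mem this
  | succ m ih =>
    intro y d hd hm hy hyd hyd'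
    by_cases hz : d ∈ Z
    · exact reaches_of_mem hz
    obtain ⟨e, hde, he, hh⟩ := hd.exists_next hz
    have hn : ¬ G.skeleton.Adj y e := by
      intro hadj
      rcases skeleton_adj.1 hadj with ha | ha
      · have := ReachesIn.height_le (m := G.height Z e + 1) ⟨e, ha, he.reachesIn_height⟩
        omega
      · exact arrow_no_triangle hyd hde ha
    have hne : y ≠ e := by
      rintro rfl
      exact arrow_asymm hyd hde
    have hde' := hGH.arrow_of_chain hne hn hde hyd'
    exact (ih d e he (by omega) (by omega) hde hde').head hde'

theorem ActiveSeq.replace {n k : ℕ} {f : ℕ → V} (h : G.ActiveSeq Z n f) (hk : k + 2 ≤ n)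
    (hc : G.Collider (f k) (f (k + 1)) (f (k + 2))) {d : V} (hd : G.Reaches Z d)
    (hc' : G.Collider (f k) d (f (k + 2))) :
    G.ActiveSeq Z n (Function.update f (k + 1) d) where
  adj l hl := by
    rcases eq_or_ne l k with rfl | h1
    · simpa [Function.update_apply] using skeleton_adj.2 (.inl hc'.1)
    rcases eq_or_ne l (k + 1) with rfl | h2
    · simpa [Function.update_apply] using skeleton_adj.2 (.inr hc'.2)
    simpa [Function.update_apply, h1, h2] using h.adj l hl
  unblocked l hl := by
    rcases eq_or_ne l k with rfl | h1
    · have : G.Unblocked Z (f l) d (f (l + 2)) := ⟨fun _ => hd, fun hn => (hn hc').elim⟩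
      simpa [Function.update_apply] using this
    rcases eq_or_ne l (k + 1) with rfl | h2
    · have := ((h.unblocked (k + 1) hl).symm.of_arrow_left hc.2 hc'.2).symm
      simpa [Function.update_apply] using this
    rcases eq_or_ne (l + 2) (k + 1) with h3 | h3
    · obtain rfl : k = l + 1 := by omega
      have := (h.unblocked l hl).of_arrow_left hc.1 hc'.1
      simpa [Function.update_apply, show l ≠ l + 1 + 1 by omega] using this
    · simpa [Function.update_apply, h1, h2, h3] using h.unblocked l hl

/-- A shortest active sequence in `G` whose colliders are, in total, as close to `Z` as possible
is active in every graph with the same pattern. -/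
theorem IsShortest.activeSeq_of_samePattern {n : ℕ} {f : ℕ → V} (h : G.IsShortest Z n f)
    (hGH : SamePattern G H)
    (hmin : ∀ g, G.ActiveSeq Z n g → g 0 = f 0 → g n = f n →
      ∑ k ∈ Finset.range n, G.height Z (f k) ≤ ∑ k ∈ Finset.range n, G.height Z (g k)) :
    H.ActiveSeq Z n f where
  adj k hk := (hGH.adj _ _).1 (h.1.adj k hk)
  unblocked k hk := by
    have hu := h.1.unblocked k hk
    rw [Unblocked, ← h.collider_iff hGH hk]
    refine ⟨fun hc => ?_, hu.2⟩
    by_cases hz : f (k + 1) ∈ Z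
    · exact reaches_of_mem hz
    obtain ⟨d, hyd, hd, hh⟩ := (hu.1 hc).exists_next hz
    have hxz := h.collider_not_adj hk hc
    have hne : f k ≠ f (k + 2) := h.ne (by omega) (by omega)
    have hcH := hGH.arrow_of_collider hc hne hxz
    suffices hyd' : H.Arrow (f (k + 1)) d from
      (hGH.reaches_of_height _ _ _ hd rfl hh hyd hyd').head hyd'
    have hxd : f k ≠ d := fun h' => arrow_asymm hc.1 (h' ▸ hyd)
    have hzd : f (k + 2) ≠ d := fun h' => arrow_asymm hc.2 (h' ▸ hyd)
    by_cases h1 : G.skeleton.Adj (f k) d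
    · by_cases h2 : G.skeleton.Adj (f (k + 2)) d
      · exfalso
        have h1' := (skeleton_adj.1 h1).resolve_right fun h' => arrow_no_triangle hc.1 hyd h'
        have h2' := (skeleton_adj.1 h2).resolve_right fun h' => arrow_no_triangle hc.2 hyd h'
        -- Both neighbours point to `d`, so `d` can replace the collider and lowers the sum at that
        -- position alone. The junk height `0` of vertices not reaching `Z` is harmless, as both
        -- exchanged vertices reach it.
        refine absurd (hmin _ (h.1.replace hk hc hd ⟨h1', h2'⟩) ?_ ?_) (not_le.2 ?_)
        · simp
        · simp [show n ≠ k + 1 by omega]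
        · refine Finset.sum_lt_sum (fun l _ => ?_) ⟨k + 1, Finset.mem_range.2 (by omega), ?_⟩
          · rcases eq_or_ne l (k + 1) with rfl | hl
            · simp [hh]
            · simp [hl]
          · simp [hh]
      · exact hGH.arrow_of_chain hzd h2 hyd hcH.2
    · exact hGH.arrow_of_chain hxd h1 hyd hcH.1

theorem ActiveSeq.exists_of_samePattern {n : ℕ} {f : ℕ → V} (h : G.ActiveSeq Z n f)
    (hGH : SamePattern G H) :
    ∃ m g, H.ActiveSeq Z m g ∧ (∀ i j, i < j → j ≤ m → g i ≠ g j) ∧ g 0 = f 0 ∧ g m = f n := by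
  classical
  have hex : ∃ m, ∃ g, G.ActiveSeq Z m g ∧ g 0 = f 0 ∧ g m = f n := ⟨n, f, h, rfl, rfl⟩
  obtain ⟨m, hm, hmmin⟩ : ∃ m, (∃ g, G.ActiveSeq Z m g ∧ g 0 = f 0 ∧ g m = f n) ∧
      ∀ m', (∃ g, G.ActiveSeq Z m' g ∧ g 0 = f 0 ∧ g m' = f n) → m ≤ m' :=
    ⟨Nat.find hex, Nat.find_spec hex, fun _ => Nat.find_min' hex⟩
  obtain ⟨g, ⟨hg, hg0, hgm⟩, hmin⟩ := exists_minimalFor_of_wellFoundedLT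
    (fun g : ℕ → V => G.ActiveSeq Z m g ∧ g 0 = f 0 ∧ g m = f n)
    (fun g => ∑ k ∈ Finset.range m, G.height Z (g k)) hm
  have hs : G.IsShortest Z m g :=
    ⟨hg, fun m' g' hg' h0 h1 => hmmin m' ⟨g', hg', h0.trans hg0, h1.trans hgm⟩⟩
  refine ⟨m, g, hs.activeSeq_of_samePattern hGH fun g' hg' h0 h1 => ?_,
    fun i j hij hj => hs.ne hij hj, hg0, hgm⟩
  exact (le_total _ _).elim id (hmin ⟨hg', h0.trans hg0, h1.trans hgm⟩)

/-! ### From sequences back to paths and d-separation. -/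

theorem isActive_iff_activeSeq {a b : V} (p : G.skeleton.Walk a b) :
    G.IsActive Z p ↔ G.ActiveSeq Z p.length p.getVert :=
  ⟨fun h => ⟨fun _ hk => p.adj_getVert_succ hk, h⟩, fun h => h.2⟩

theorem exists_walk_getVert (S : SimpleGraph V) (n : ℕ) :
    ∀ f : ℕ → V, (∀ k < n, S.Adj (f k) (f (k + 1))) →
      ∃ p : S.Walk (f 0) (f n), p.length = n ∧ ∀ k ≤ n, p.getVert k = f k := by
  induction n with
  | zero => exact fun f _ => ⟨.nil, rfl, fun k hk => by simp [Nat.le_zero.1 hk]⟩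
  | succ n ih =>
    intro f hf
    obtain ⟨p, hp, hv⟩ := ih (fun k => f (k + 1)) fun k hk => hf (k + 1) (by omega)
    refine ⟨.cons (hf 0 (by omega)) p, by simp [hp], fun k hk => ?_⟩
    cases k with
    | zero => simp
    | succ k => simpa using hv k (by omega)

theorem SamePattern.exists_isActive (hGH : SamePattern G H) {a b : V} {p : G.skeleton.Walk a b}
    (hp : G.IsActive Z p) : ∃ q : H.skeleton.Walk a b, q.IsPath ∧ H.IsActive Z q := by
  obtain ⟨m, g, hg, hinj, h0, hm⟩ :=
    ((isActive_iff_activeSeq p).1 hp).exists_of_samePattern hGH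
  obtain ⟨q, hq, hv⟩ := exists_walk_getVert H.skeleton m g hg.adj
  simp only [SimpleGraph.Walk.getVert_zero, SimpleGraph.Walk.getVert_length] at h0 hm
  subst h0 hm
  refine ⟨q, ?_, ?_⟩
  · rw [← SimpleGraph.Walk.IsPath.getVert_injOn_iff]
    intro i hi j hj hij
    rw [Set.mem_ofPred_eq, hq] at hi hj
    rw [hv i hi, hv j hj] at hij
    rcases lt_trichotomy i j with h | h | h
    · exact (hinj i j h hj hij).elim
    · exact h
    · exact (hinj j i h hi hij.symm).elim
  · rw [isActive_iff_activeSeq]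
    refine ⟨fun k hk => q.adj_getVert_succ hk, fun k hk => ?_⟩
    rw [hq] at hk
    rw [hv k (by omega), hv (k + 1) (by omega), hv (k + 2) hk]
    exact hg.unblocked k hk

theorem SamePattern.dSeparated (hGH : SamePattern G H) {A B : Set V}
    (h : H.DSeparated A B Z) : G.DSeparated A B Z := by
  intro a ha b hb p _ hp
  obtain ⟨q, hq, hq'⟩ := hGH.exists_isActive hp
  exact h a ha b hb q hq hq'

/-- Directed acyclic graphs with the same skeleton and the same unshielded colliders are Markov
equivalent. -/
theorem SamePattern.markovEquivalent (hGH : SamePattern G H) : MarkovEquivalent G H :=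
  fun _ _ _ _ _ _ => ⟨hGH.symm.dSeparated, hGH.dSeparated⟩

end Markov


/-! ### Stability and star-shaped covariances. -/

section Lyapunov

open Matrix

variable {V : Type*} [Fintype V] [DecidableEq V] {G H : DAG V} {C : Matrix V V ℝ}

/-- Solutions of the Lyapunov equation with positive definite covariance are stable. -/
theorem isStable_of_lyapunov {M S : Matrix V V ℝ} (hC : C.PosDef) (hS : S.PosDef)
    (h : M * S + S * Mᵀ + C = 0) : IsStable M := by
  intro z hz
  have hz' : z ∈ spectrum ℂ (Mᵀ.map (algebraMap ℝ ℂ)) := by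
    rw [mem_spectrum_iff_isRoot_charpoly] at hz ⊢
    rwa [transpose_map, charpoly_transpose]
  rw [← spectrum_toLin', ← Module.End.hasEigenvalue_iff_mem_spectrum] at hz'
  obtain ⟨v, hv⟩ := hz'.exists_hasEigenvector
  have hvz := hv.apply_eq_smul
  rw [toLin'_apply] at hvz
  set x : V → ℝ := fun i => (v i).re
  set y : V → ℝ := fun i => (v i).im
  have hx : Mᵀ *ᵥ x = z.re • x - z.im • y := by
    ext i
    have := congrArg Complex.re (congrFun hvz i)
    simpa [mulVec, dotProduct, x, y] using this
  have hy : Mᵀ *ᵥ y = z.im • x + z.re • y := by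
    ext i
    have := congrArg Complex.im (congrFun hvz i)
    simp only [mulVec, dotProduct, map_apply, transpose_apply, Complex.coe_algebraMap,
      Complex.im_sum, Pi.smul_apply, smul_eq_mul, Complex.mul_im, Complex.ofReal_re,
      Complex.ofReal_im, zero_mul, add_zero] at this
    simp only [mulVec, dotProduct, transpose_apply, Pi.add_apply, Pi.smul_apply, smul_eq_mul, x, y]
    linarith
  have key (w : V → ℝ) : 2 * ((Mᵀ *ᵥ w) ⬝ᵥ (S *ᵥ w)) + w ⬝ᵥ (C *ᵥ w) = 0 := by
    have h1 : w ⬝ᵥ ((M * S + S * Mᵀ + C) *ᵥ w) = 0 := by simp [h]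
    have hSt : Sᵀ = S := by simpa using hS.isHermitian.eq
    have h2 : w ⬝ᵥ ((M * S) *ᵥ w) = (Mᵀ *ᵥ w) ⬝ᵥ (S *ᵥ w) := by
      rw [← mulVec_mulVec, dotProduct_mulVec, ← mulVec_transpose]
    have h3 : w ⬝ᵥ ((S * Mᵀ) *ᵥ w) = (Mᵀ *ᵥ w) ⬝ᵥ (S *ᵥ w) := by
      rw [← mulVec_mulVec, dotProduct_mulVec, ← mulVec_transpose, hSt, dotProduct_comm]
    rw [add_mulVec, add_mulVec, dotProduct_add, dotProduct_add, h2, h3] at h1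
    linarith
  have hsymm : y ⬝ᵥ (S *ᵥ x) = x ⬝ᵥ (S *ᵥ y) := by
    have hSt : Sᵀ = S := by simpa using hS.isHermitian.eq
    rw [dotProduct_mulVec, ← mulVec_transpose, hSt, dotProduct_comm]
  have hxk := key x
  have hyk := key y
  rw [hx, sub_dotProduct, smul_dotProduct, smul_dotProduct, smul_eq_mul, smul_eq_mul] at hxk
  rw [hy, add_dotProduct, smul_dotProduct, smul_dotProduct, smul_eq_mul, smul_eq_mul] at hyk
  have hnn {A : Matrix V V ℝ} (hA : A.PosDef) (w : V → ℝ) : 0 ≤ w ⬝ᵥ (A *ᵥ w) := by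
    simpa using hA.posSemidef.dotProduct_mulVec_nonneg w
  have hpos {A : Matrix V V ℝ} (hA : A.PosDef) : 0 < x ⬝ᵥ (A *ᵥ x) + y ⬝ᵥ (A *ᵥ y) := by
    by_cases hx0 : x = 0
    · have hy0 : y ≠ 0 := fun hy0 => hv.2 <| funext fun i =>
        Complex.ext (congrFun hx0 i) (congrFun hy0 i)
      exact add_pos_of_nonneg_of_pos (hnn hA x) (by simpa using hA.dotProduct_mulVec_pos hy0)
    · exact add_pos_of_pos_of_nonneg (by simpa using hA.dotProduct_mulVec_pos hx0) (hnn hA y)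
  have h1 := hpos hS
  have h2 := hpos hC
  -- For the eigenvector `v = x + iy` of `Mᵀ` this is `2 Re(z) v*Sv = -v*Cv`; the cross terms cancel
  -- by symmetry of `S`.
  have h3 : 2 * z.re * (x ⬝ᵥ (S *ᵥ x) + y ⬝ᵥ (S *ᵥ y)) < 0 := by
    linear_combination h2 + hxk + hyk + 2 * z.im * hsymm
  by_contra hneg
  exact absurd h3 (not_lt.2 (by have := not_lt.1 hneg; positivity))

/-- The covariance matrix with unit variances in which the only correlated pairs are `b` and
other coordinates `i`, with covariance `u i`. -/
def starCov (b : V) (u : V → ℝ) : Matrix V V ℝ :=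
  fun i j => (if i = j then 1 else 0) + (if j = b then u i else 0) + (if i = b then u j else 0)

omit [Fintype V] in
theorem starCov_isSymm (b : V) (u : V → ℝ) : (starCov b u)ᵀ = starCov b u := by
  ext i j
  simp only [transpose_apply, starCov, eq_comm (a := j) (b := i)]
  ring

theorem mul_starCov (M : Matrix V V ℝ) (b : V) (u : V → ℝ) (i j : V) :
    (M * starCov b u) i j = M i j + (if j = b then ∑ p, M i p * u p else 0) + M i b * u j := by
  simp only [mul_apply, starCov, mul_add, Finset.sum_add_distrib]
  congr 2
  · simp
  · split_ifs <;> simp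
  · simp

theorem lyapunov_starCov_apply (M : Matrix V V ℝ) (b : V) (u : V → ℝ) (i j : V) :
    (M * starCov b u + starCov b u * Mᵀ + C) i j =
      (M * starCov b u) i j + (M * starCov b u) j i + C i j := by
  have : starCov b u * Mᵀ = (M * starCov b u)ᵀ := by rw [transpose_mul, starCov_isSymm]
  rw [this]
  rfl

theorem starCov_posDef {b : V} {u : V → ℝ} (hb : u b = 0) (hu : ∑ p, u p ^ 2 < 1) :
    (starCov b u).PosDef := by
  refine PosDef.of_dotProduct_mulVec_pos (by simpa [IsHermitian] using starCov_isSymm b u)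
    fun x hx => ?_
  -- Completing the square in every coordinate other than `b`.
  have h1 : star x ⬝ᵥ (starCov b u *ᵥ x) =
      ∑ p, (if p = b then 0 else (x p + u p * x b) ^ 2) + x b ^ 2 * (1 - ∑ p, u p ^ 2) := by
    have e1 : starCov b u *ᵥ x = x + x b • u + Pi.single b (u ⬝ᵥ x) := by
      ext i
      simp only [mulVec, dotProduct, starCov, add_mul, Finset.sum_add_distrib, Pi.add_apply,
        Pi.smul_apply, smul_eq_mul, Pi.single_apply]
      congr 2
      · simp
      · simp [mul_comm]
      · split_ifs <;> simp
    have e2 (p : V) : (if p = b then 0 else (x p + u p * x b) ^ 2) =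
        (x p + u p * x b) ^ 2 - if p = b then x b ^ 2 else 0 := by
      split_ifs with h
      · subst h; simp [hb]
      · simp
    simp only [e1, e2, star_trivial, dotProduct_add, dotProduct_smul, dotProduct_single,
      Finset.sum_sub_distrib, Finset.sum_ite_eq', Finset.mem_univ, if_true, smul_eq_mul]
    simp only [dotProduct, add_sq, Finset.sum_add_distrib, mul_pow, ← Finset.sum_mul]
    have e3 : ∑ p, 2 * x p * (u p * x b) = 2 * x b * ∑ p, x p * u p := by
      rw [Finset.mul_sum]
      exact Finset.sum_congr rfl fun p _ => by ring
    have e4 : ∑ p, u p * x p = ∑ p, x p * u p := Finset.sum_congr rfl fun p _ => mul_comm _ _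
    have e5 : ∑ p, x p * x p = ∑ p, x p ^ 2 := Finset.sum_congr rfl fun p _ => by ring
    rw [e3, e4, e5]
    ring
  rw [h1]
  have h0 : 0 ≤ ∑ p, (if p = b then 0 else (x p + u p * x b) ^ 2) :=
    Finset.sum_nonneg fun p _ => by split_ifs <;> positivity
  by_cases hxb : x b = 0
  · obtain ⟨p, hp⟩ := Function.ne_iff.1 hx
    have hpb : p ≠ b := fun h => hp (by simp [h, hxb])
    have : 0 < ∑ p, (if p = b then 0 else (x p + u p * x b) ^ 2) := by
      refine Finset.sum_pos' (fun p _ => by split_ifs <;> positivity) ⟨p, Finset.mem_univ p, ?_⟩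
      simp only [hpb, if_false, hxb, mul_zero, add_zero]
      have : x p ≠ 0 := hp
      positivity
    simpa [hxb] using this
  · have : 0 < 1 - ∑ p, u p ^ 2 := by linarith
    positivity

/-- Correlating a vertex with some of its parents gives a covariance matrix in the model. -/
theorem starCov_mem_lyapunovModel (hC : C.PosDef) (hdiag : C.IsDiag) {b : V} {u : V → ℝ}
    (hb : u b = 0) (hu : ∑ p, u p ^ 2 < 1) (hG : ∀ p, u p ≠ 0 → G.Adj p b) :
    starCov b u ∈ lyapunovModel C G := by
  -- Entries `(b, j)` of the Lyapunov equation force the off-diagonal part of row `b` in terms of `m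
  -- = M b b`; what remains is the `(b, b)` entry, linear in `m`.
  obtain ⟨m, hm⟩ : ∃ m : ℝ, m + ∑ p, u p ^ 2 * (C p p / 2 - m) = - C b b / 2 := by
    refine ⟨-(C b b + ∑ p, u p ^ 2 * C p p) / 2 / (1 - ∑ p, u p ^ 2), ?_⟩
    have h1 : 1 - ∑ p, u p ^ 2 ≠ 0 := by linarith
    simp only [mul_sub, Finset.sum_sub_distrib, ← Finset.sum_mul, ← mul_div_assoc,
      ← Finset.sum_div]
    field_simp
    ring
  set M : Matrix V V ℝ := fun i j =>
    if i = b then (if j = b then m else u j * (C j j / 2 - m))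
    else (if i = j then - C i i / 2 else 0) with hM
  have hsum : ∑ p, M b p * u p = ∑ p, u p ^ 2 * (C p p / 2 - m) := by
    refine Finset.sum_congr rfl fun p _ => ?_
    by_cases hp : p = b
    · simp [hp, hb]
    · simp only [hM, hp, if_true, if_false]
      ring
  have hsum' {i : V} (hi : i ≠ b) : ∑ p, M i p * u p = - C i i / 2 * u i := by
    simp [hM, hi]
  have hS := starCov_posDef hb hu
  have hL : M * starCov b u + starCov b u * Mᵀ + C = 0 := by
    ext i j
    rw [lyapunov_starCov_apply, mul_starCov, mul_starCov, Matrix.zero_apply]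
    by_cases hi : i = b <;> by_cases hj : j = b
    · subst hi hj
      simp only [if_true, hsum, hb]
      simp only [hM, if_true]
      linarith
    · subst hi
      simp only [if_true, hsum' hj, hj, if_false, hb, hdiag (Ne.symm hj)]
      simp only [hM, if_true, hj, if_false]
      ring
    · subst hj
      simp only [if_true, hsum' hi, hi, if_false, hb, hdiag hi]
      simp only [hM, if_true, hi, if_false]
      ring
    · rcases eq_or_ne i j with rfl | hij
      · simp [hM, hi]
      · simp [hM, hi, hj, hij, hij.symm, hdiag hij]
  refine ⟨hS, M, fun i j hij => ?_, isStable_of_lyapunov hC hS hL, hL⟩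
  by_cases hj : j = b
  · subst hj
    have hi : i ≠ j := fun h => hij (h ▸ G.loop i)
    have hui : u i = 0 := by
      by_contra h
      exact hij (hG i h)
    simp [hM, hi, hui]
  · have hji : j ≠ i := fun h => hij (h ▸ G.loop j)
    simp [hM, hj, hji]

/-! ### Reading the pattern off the model. -/

omit [Fintype V] [DecidableEq V] in
theorem entry_eq_zero_of_mem_sparse {M : Matrix V V ℝ} (hM : M ∈ G.sparse) {i j : V}
    (hij : i ≠ j) (h : ¬ G.Arrow i j) : M j i = 0 :=
  hM i j fun h' => h ⟨hij, h'⟩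

/-- Without an edge in `H`, the diagonal entries make `M a a` and `M b b` negative, while the `(a,
b)` entry makes their sum zero. -/
theorem skeleton_adj_of_lyapunovModel_subset (hC : C.PosDef) (hdiag : C.IsDiag)
    (h : lyapunovModel C G ⊆ lyapunovModel C H) {a b : V} (hab : G.Arrow a b) :
    H.skeleton.Adj a b := by
  by_contra hn
  rw [skeleton_adj, not_or] at hn
  have hne : a ≠ b := hab.1
  obtain ⟨-, M, hM, -, hL⟩ := h (starCov_mem_lyapunovModel hC hdiag (b := b)
    (u := Pi.single a (1 / 2)) (by simp [hne.symm])
    (by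
      rw [Finset.sum_eq_single a (fun p _ hp => by simp [hp]) (by simp)]
      norm_num)
    (fun p hp => by
      obtain rfl : p = a := by
        by_contra hpa
        exact hp (by simp [hpa])
      exact hab.2))
  have e (i j : V) := congrFun (congrFun hL i) j
  simp only [lyapunov_starCov_apply, mul_starCov] at e
  have hba := entry_eq_zero_of_mem_sparse hM hne hn.1
  have hab' := entry_eq_zero_of_mem_sparse hM hne.symm hn.2
  have h1 := e a a
  have h2 := e b b
  have h3 := e a b
  simp [hne, hne.symm, hba, hab', hdiag hne, Pi.single_apply] at h1 h2 h3
  have := hC.diag_pos (i := a)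
  have := hC.diag_pos (i := b)
  linarith

theorem arrow_of_lyapunovModel_subset (hC : C.PosDef) (hdiag : C.IsDiag)
    (h : lyapunovModel C G ⊆ lyapunovModel C H) {a b c : V} (hac : a ≠ c)
    (hn : ¬ H.skeleton.Adj a c) (hc : G.Collider a b c) : H.Arrow a b := by
  by_contra hab
  rw [skeleton_adj, not_or] at hn
  have hne : a ≠ b := hc.1.1
  have hcb : c ≠ b := hc.2.1
  obtain ⟨-, M, hM, -, hL⟩ := h (starCov_mem_lyapunovModel hC hdiag (b := b)
    -- The squares sum to `1/2 < 1`, as positive definiteness requires.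
    (u := Pi.single a (1 / 2) + Pi.single c (1 / 2)) (by simp [hne.symm, hcb.symm])
    (by
      rw [← Finset.sum_subset (Finset.subset_univ {a, c}), Finset.sum_pair hac]
      · simp [hac, hac.symm]
        norm_num
      · intro p _ hp
        simp only [Finset.mem_insert, Finset.mem_singleton, not_or] at hp
        simp [hp.1, hp.2])
    (fun p hp => by
      by_cases hpa : p = a
      · exact hpa ▸ hc.1.2
      by_cases hpc : p = c
      · exact hpc ▸ hc.2.2
      · exact (hp (by simp [hpa, hpc])).elim))
  have e (i j : V) := congrFun (congrFun hL i) j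
  have hs (i : V) : ∑ p, M i p * (Pi.single a (1 / 2) + Pi.single c (1 / 2) : V → ℝ) p =
      (M i a + M i c) / 2 := by
    simp only [Pi.add_apply, mul_add, Finset.sum_add_distrib, Pi.single_apply, mul_ite, mul_zero,
      Finset.sum_ite_eq', Finset.mem_univ, if_true]
    ring
  simp only [lyapunov_starCov_apply, mul_starCov, hs] at e
  have hMba := entry_eq_zero_of_mem_sparse hM hne hab
  have hMca := entry_eq_zero_of_mem_sparse hM hac hn.1
  have hMac := entry_eq_zero_of_mem_sparse hM hac.symm hn.2
  have haa := e a a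
  have hbb := e b b
  have hcc := e c c
  have hab' := e a b
  have hbc := e b c
  have hac' := e a c
  simp [hne, hne.symm, hac, hac.symm, hcb, hcb.symm, hMba, hMca, hMac, hdiag hne, hdiag hcb.symm,
    hdiag hac] at haa hbb hcc hab' hbc hac'
  have hca := hC.diag_pos (i := a)
  have hcb' := hC.diag_pos (i := b)
  have hcc' := hC.diag_pos (i := c)
  -- The `(a, c)` entry gives `M a b + M c b = 0`. If `c → b` in `H`, both vanish and the other
  -- entries determine `M b b` and `M b c`, contradicting the `(b, b)` entry. Otherwise `M b c = 0`,
  -- and adding the `(a, b)` and `(b, c)` entries equates a negative number with zero.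
  by_cases hcb2 : H.Arrow c b
  · have hMcb := entry_eq_zero_of_mem_sparse hM hcb.symm fun h' => arrow_asymm hcb2 h'
    simp only [hMcb] at *
    linarith
  · have hMbc := entry_eq_zero_of_mem_sparse hM hcb hcb2
    simp only [hMbc] at *
    linarith

theorem samePattern_of_modelEquivalent (hC : C.PosDef) (hdiag : C.IsDiag)
    (h : ModelEquivalent C G H) : SamePattern G H := by
  have hadj (a b : V) : G.skeleton.Adj a b ↔ H.skeleton.Adj a b := by
    constructor <;> intro hab <;> rcases skeleton_adj.1 hab with hab | hab
    · exact skeleton_adj_of_lyapunovModel_subset hC hdiag h.subset hab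
    · exact (skeleton_adj_of_lyapunovModel_subset hC hdiag h.subset hab).symm
    · exact skeleton_adj_of_lyapunovModel_subset hC hdiag h.superset hab
    · exact (skeleton_adj_of_lyapunovModel_subset hC hdiag h.superset hab).symm
  refine ⟨hadj, fun a b c hac hn => ⟨fun hc => ?_, fun hc => ?_⟩⟩
  · have hn' : ¬ H.skeleton.Adj a c := by rwa [← hadj]
    exact ⟨arrow_of_lyapunovModel_subset hC hdiag h.subset hac hn' hc,
      arrow_of_lyapunovModel_subset hC hdiag h.subset hac.symm (fun h' => hn' h'.symm) hc.symm⟩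
  · exact ⟨arrow_of_lyapunovModel_subset hC hdiag h.superset hac hn hc,
      arrow_of_lyapunovModel_subset hC hdiag h.superset hac.symm (fun h' => hn h'.symm) hc.symm⟩

end Lyapunov

end DAG

/-- For every diagonal positive definite volatility matrix, the partition of the DAGs on `V` into
Lyapunov model equivalence classes refines the partition into Markov equivalence classes;
that is, DAGs which are not Markov equivalent are not Lyapunov model equivalent. -/
theorem mainTheorem5 {V : Type*} [Fintype V] [DecidableEq V] (C : Matrix V V ℝ)
    (hC : C.PosDef) (hdiag : C.IsDiag) :
    DAG.modelSetoid C ≤ DAG.markovSetoid V ∧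
      ∀ G₁ G₂ : DAG V, ¬ DAG.MarkovEquivalent G₁ G₂ → ¬ DAG.ModelEquivalent C G₁ G₂ :=
  have key (G₁ G₂ : DAG V) (h : DAG.ModelEquivalent C G₁ G₂) : DAG.MarkovEquivalent G₁ G₂ :=
    (DAG.samePattern_of_modelEquivalent hC hdiag h).markovEquivalent
  ⟨fun G₁ G₂ h => key G₁ G₂ h, fun G₁ G₂ h h' => h (key G₁ G₂ h')⟩
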